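/- Let $H$ be the multigraph with vertices $0,1,\dots,8$ and the fifteen edges $04,04,15,15,06,16,26,07,17,47,57,38,48,58,68$ (a repeated pair denotes parallel edges; the sparse6 code of $H$ is `:Hg?COoAI?QDeOhn`). For $k\ge 2$ let $G_k$ be the multigraph obtained from $k$ disjoint copies of $H$, indexed modulo $k$, by identifying, for each $i$, vertex $3$ of the $i$-th copy with vertex $2$ of the $(i+1)$-st copy and then suppressing the resulting vertex of degree $2$ (that is, replacing it and its two incident edges by a single edge between its two neighbours). For a finite multigraph $G$, a circular $r$-edge-colouring ($r\ge 1$ real) assigns to each edge a number in $[0,r)$ so that $1\le |c(e)-c(f)|\le r-1$ for any two distinct edges $e,f$ with a common end (a multigraph with a loop has no such colouring); the circular chromatic index $\chi_c'(G)$ is the least $r$ for which such a colouring exists. A multigraph is $2$-connected if it has at least three vertices, is connected, and remains connected after the deletion of any one vertex. Theorem. The multigraph $H$ has exactly two vertices of degree $1$ (namely $2$ and $3$), its seven other vertices have degree $4$, and $\chi_c'(H)=14/3$. For every even $k\ge 2$, the finite multigraph $G_k$ is $2$-connected, $4$-regular, and satisfies $\chi_c'(G_k)=4+\tfrac23=\tfrac{14}{3}$.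 The multigraphs $G_k$ ($k\ge 2$ even) are pairwise nonisomorphic; in particular, there are infinitely many $2$-connected $4$-regular multigraphs $G$ with $\chi_c'(G)=4+\tfrac23$. -/

import Mathlib

/-!
Finite multigraphs are terms of Mathlib's `Graph α β` (vertices in `α`, edges in `β`, parallel
edges allowed) with finite vertex and edge sets.
-/

namespace Graph

/-- The multigraph has finitely many vertices and finitely many edges. -/
def IsFinite {α β : Type*} (G : Graph α β) : Prop :=
  G.vertexSet.Finite ∧ G.edgeSet.Finite

/-- The degree of a vertex: the number of incident edges, loops counted twice. -/
noncomputable def degree {α β : Type*} (G : Graph α β) (x : α) : ℕ :=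
  (G.incidenceSet x).ncard + (G.loopSet x).ncard

/-- Every vertex has degree `d`. -/
def IsRegular {α β : Type*} (G : Graph α β) (d : ℕ) : Prop :=
  ∀ x ∈ G.vertexSet, G.degree x = d

/-- The multigraph is nonempty and any two of its vertices are joined by a path. (Parallel edges
and loops do not matter for this, so it is read off from the underlying simple graph.) -/
def IsConnected {α β : Type*} (G : Graph α β) : Prop :=
  G.toSimpleGraph.Connected

/-- `2`-connectedness (in the sense of vertex connectivity): at least three vertices, connected,
and still connected after the deletion of any single vertex. -/
def IsTwoConnected {α β : Type*} (G : Graph α β) : Prop :=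
  3 ≤ G.vertexSet.encard ∧ G.IsConnected ∧
    ∀ x ∈ G.vertexSet, (G.deleteVerts {x}).IsConnected

/-- Two multigraphs are isomorphic. -/
def Isomorphic {α β α' β' : Type*} (G : Graph α β) (G' : Graph α' β') : Prop :=
  ∃ (φ : G.vertexSet ≃ G'.vertexSet) (ψ : G.edgeSet ≃ G'.edgeSet),
    ∀ (e : G.edgeSet) (x y : G.vertexSet), G.IsLink e x y ↔ G'.IsLink (ψ e) (φ x) (φ y)

/-- `c` is a circular `r`-edge-colouring of `G`: edges get colours in `[0, r)`, and
`1 ≤ |c e - c f| ≤ r - 1` whenever `e` and `f` are distinct edges with a common end.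
A multigraph with a loop has no such colouring. As usual, only `r ≥ 1` is considered (this
is automatic as soon as two edges have a common end). -/
structure IsCircularEdgeColouring {α β : Type*} (G : Graph α β) (r : ℝ) (c : β → ℝ) : Prop where
  one_le : 1 ≤ r
  not_isLoopAt : ∀ e x, ¬ G.IsLoopAt e x
  mem_Ico : ∀ e ∈ G.edgeSet, c e ∈ Set.Ico 0 r
  dist_bounds : ∀ e f x, e ≠ f → G.Inc e x → G.Inc f x → 1 ≤ |c e - c f| ∧ |c e - c f| ≤ r - 1

/-- `r` is the circular chromatic index of `G`: the least real number `r` for which `G` admits a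
circular `r`-edge-colouring. -/
def HasCircularChromaticIndex {α β : Type*} (G : Graph α β) (r : ℝ) : Prop :=
  IsLeast {s : ℝ | ∃ c : β → ℝ, G.IsCircularEdgeColouring s c} r

/-- The multigraph with vertex set `α` and edge set `β`, where the edge `e` joins the two members
of `ends e`. -/
def ofEnds {α β : Type*} (ends : β → Sym2 α) : Graph α β where
  vertexSet := Set.univ
  IsLink e x y := ends e = s(x, y)
  edgeSet := Set.univ
  isLink_symm := fun e _ => ⟨fun x y h => h.trans Sym2.eq_swap⟩
  eq_or_eq_of_isLink_of_isLink := by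
    intro e x y v w h h'
    rcases Sym2.eq_iff.1 (h.symm.trans h') with h | h
    · exact Or.inl h.1
    · exact Or.inr h.1
  edge_mem_iff_exists_isLink := by
    intro e
    refine ⟨fun _ => ?_, fun _ => Set.mem_univ _⟩
    induction h : ends e using Sym2.ind with
    | _ x y => exact ⟨x, y, rfl⟩
  left_mem_of_isLink := fun _ _ _ _ => Set.mem_univ _

/-- The cyclic construction. Let `u ≠ v` be vertices of degree `1` of `H`. Take `k` copies of `H`,
indexed modulo `k`, identify `v` in copy `i` with `u` in copy `i + 1` for each `i`, and suppress the
resulting vertices of degree `2`.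

The vertices are the pairs `(i, x)` with `x ≠ u, v` a vertex of `H` (the vertex `x` of copy `i`).
The edge `(i, inl e)` is the edge `e` of copy `i`, for `e` incident neither with `u` nor with `v`.
The edge `(i, inr (f, g))` is what becomes of the edge `f` at `v` in copy `i` and the edge `g`
at `u` in copy `i + 1`: it joins the other end of `f` in copy `i` with the other end of `g` in
copy `i + 1`. (As `u` and `v` have degree `1`, there is just one pair `(f, g)`.) -/
def cyclicChain {α β : Type*} (H : Graph α β) (u v : α) (k : ℕ) :
    Graph (ZMod k × α) (ZMod k × (β ⊕ β × β)) where
  vertexSet := {p | p.2 ∈ H.vertexSet ∧ p.2 ≠ u ∧ p.2 ≠ v}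
  IsLink a p q :=
    (p.2 ≠ u ∧ p.2 ≠ v) ∧ (q.2 ≠ u ∧ q.2 ≠ v) ∧
    match a with
    | (i, Sum.inl e) => p.1 = i ∧ q.1 = i ∧ H.IsLink e p.2 q.2
    | (i, Sum.inr (f, g)) =>
        (p.1 = i ∧ H.IsLink f v p.2 ∧ q.1 = i + 1 ∧ H.IsLink g u q.2) ∨
        (q.1 = i ∧ H.IsLink f v q.2 ∧ p.1 = i + 1 ∧ H.IsLink g u p.2)
  isLink_symm := by
    rintro ⟨i, e | ⟨f, g⟩⟩ -
    · exact ⟨fun p q h => ⟨h.2.1, h.1, h.2.2.2.1, h.2.2.1, h.2.2.2.2.symm⟩⟩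
    · exact ⟨fun p q h => ⟨h.2.1, h.1, h.2.2.symm⟩⟩
  eq_or_eq_of_isLink_of_isLink := by
    rintro ⟨i, e | ⟨f, g⟩⟩ ⟨p1, p2⟩ ⟨q1, q2⟩ ⟨s1, s2⟩ ⟨t1, t2⟩ ⟨-, -, h⟩ ⟨-, -, h'⟩
    · obtain ⟨rfl, rfl, h⟩ := h
      obtain ⟨h1, h2, h'⟩ := h'
      simp only at h1 h2 h h'
      subst h1
      subst h2
      rcases h.left_eq_or_eq h' with h | h
      · exact Or.inl (by rw [h])
      · exact Or.inr (by rw [h])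
    · simp only [Prod.mk.injEq] at h h' ⊢
      rcases h with ⟨a, b, -, -⟩ | ⟨-, -, a, b⟩ <;>
      rcases h' with ⟨c, d, c', d'⟩ | ⟨c, d, c', d'⟩
      · exact Or.inl ⟨a.trans c.symm, b.right_unique d⟩
      · exact Or.inr ⟨a.trans c.symm, b.right_unique d⟩
      · exact Or.inr ⟨a.trans c'.symm, b.right_unique d'⟩
      · exact Or.inl ⟨a.trans c'.symm, b.right_unique d'⟩
  left_mem_of_isLink := by
    rintro ⟨i, e | ⟨f, g⟩⟩ p q ⟨hp, -, h⟩
    · exact ⟨h.2.2.left_mem, hp⟩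
    · rcases h with h | h
      · exact ⟨h.2.1.right_mem, hp⟩
      · exact ⟨h.2.2.2.right_mem, hp⟩

end Graph

/-- The multigraph with sparse6 code `:Hg?COoAI?QDeOhn`: nine vertices `0, …, 8` and the fifteen
edges listed; the vertices `2` and `3` have degree `1`. -/
def baseMultigraph : Graph (Fin 9) (Fin 15) :=
  Graph.ofEnds ![s(0, 4), s(0, 4), s(1, 5), s(1, 5), s(0, 6), s(1, 6), s(2, 6), s(0, 7), s(1, 7),
    s(4, 7), s(5, 7), s(3, 8), s(4, 8), s(5, 8), s(6, 8)]

/-! For the lower bound, a circular `r`-colouring of the fifteen edges of `H` with `r < 14/3` is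
rounded to a circular `9/2`-colouring. The rounding solves a system of difference constraints, which
works unless some cycle has positive weight. A bad cycle with `n` steps, `B` of them not ascending,
would give `9/2 < n/B < 14/3`. As `14 * 2 - 9 * 3 = 1`, such a fraction has numerator at least `9 +
14 = 23`, while `n ≤ 15` (`exists_int_colouring`). An exhaustive search shows that `H` has no
circular `9/2`-colouring (`extends92_eq_false`). Every copy of `H` in `G_k` inherits this bound.

For the upper bound, `H` has a colouring modulo `14` with pendant colours `1` (edge `6`) and `0`
(edge `11`). The reflection `x ↦ 1 - x` swaps these colours, so for even `k` the colouring and its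
reflection can alternate around the cycle. The `G_k` are told apart by their `7k` vertices. -/

/-! ### Difference constraints and rounding of circular colourings. -/

/-- The total weight of a walk, listed from its last vertex to its first. -/
def walkWeight {V : Type*} (w : V → V → ℤ) : List V → ℤ
  | [] => 0
  | [_] => 0
  | v :: u :: l => w u v + walkWeight w (u :: l)

theorem walkWeight_append {V : Type*} (w : V → V → ℤ) (l l' : List V) (v : V) :
    walkWeight w (l ++ v :: l') = walkWeight w (l ++ [v]) + walkWeight w (v :: l') := by
  induction l with
  | nil => simp [walkWeight]
  | cons a l ih =>
    cases l with
    | nil => simp [walkWeight]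
    | cons b l => simp only [List.cons_append, walkWeight] at ih ⊢; rw [ih]; ring

/-- A system of difference constraints without a cycle of positive weight has a solution. -/
theorem exists_potential {V : Type*} [Finite V] (A : V → V → Prop) (w : V → V → ℤ)
    (hw : ∀ v l, (l ++ [v]).Nodup → (v :: (l ++ [v])).IsChain (fun x y => A y x) →
      walkWeight w (v :: (l ++ [v])) ≤ 0) :
    ∃ φ : V → ℤ, ∀ u v, A u v → φ u + w u v ≤ φ v := by
  classical
  have := Fintype.ofFinite V
  let S : V → Set (List V) := fun v => {t | (v :: t).Nodup ∧ (v :: t).IsChain (fun x y => A y x)}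
  -- The potential of `v` is the largest weight of a path ending at `v`; there are finitely many
  -- paths.
  have hS : ∀ v, ∃ t ∈ S v, ∀ t' ∈ S v, walkWeight w (v :: t') ≤ walkWeight w (v :: t) := by
    intro v
    refine Set.exists_max_image (S v) (fun t => walkWeight w (v :: t)) ?_ ⟨[], by simp [S]⟩
    exact (List.finite_length_le V (Fintype.card V)).subset fun t ht =>
      (List.nodup_cons.1 ht.1).2.length_le_card
  choose T hT hmax using hS
  refine ⟨fun v => walkWeight w (v :: T v), fun u v huv => ?_⟩
  have hchain : (v :: u :: T u).IsChain (fun x y => A y x) := (hT u).2.cons_cons huv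
  have hadd : walkWeight w (v :: u :: T u) = w u v + walkWeight w (u :: T u) := rfl
  -- If the best path to `u` already meets `v`, the extended walk is a cycle through `v`, of weight
  -- at most `0`, after a path ending at `v`.
  by_cases hv : v ∈ u :: T u
  · obtain ⟨l, l', hl⟩ := List.append_of_mem hv
    have hnd := (hT u).1
    rw [hl] at hchain hadd hnd
    have h1 := walkWeight_append w (v :: l) l' v
    simp only [List.cons_append] at h1
    have hsplit : v :: (l ++ v :: l') = (v :: (l ++ [v])) ++ l' := by simp
    have h2 := hw v l (by
      rw [show l ++ v :: l' = (l ++ [v]) ++ l' by simp] at hnd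
      exact hnd.of_append_left) (by rw [hsplit] at hchain; exact hchain.left_of_append)
    have h3 := hmax v l' ⟨hnd.of_append_right, by
      rw [← List.cons_append] at hchain; exact hchain.right_of_append⟩
    dsimp only
    rw [hl] at *
    linarith
  · have := hmax v (u :: T u) ⟨List.nodup_cons.2 ⟨hv, (hT u).1⟩, hchain⟩
    dsimp only
    linarith

/-- A circular `r`-colouring with `r < 14/3` of a graph on at most fifteen vertices can be turned
into a circular `9/2`-colouring, scaled here to integers modulo `9`. -/
theorem exists_int_colouring {V : Type*} [Fintype V] (hV : Fintype.card V ≤ 15)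
    (A : V → V → Prop) (hA : ∀ u v, A u v → A v u) {r : ℝ} (hr : r < 14 / 3) (c : V → ℝ)
    (hc : ∀ u v, A u v → 1 ≤ |c u - c v| ∧ |c u - c v| ≤ r - 1) :
    ∃ φ : V → ℤ, ∀ u v, A u v → 2 ≤ |φ u - φ v| ∧ |φ u - φ v| ≤ 7 := by
  classical
  -- If `c u < c v`, the constraints for `(u, v)` and `(v, u)` together say `2 ≤ φ v - φ u ≤ 7`.
  let w : V → V → ℤ := fun u v => if c u < c v then 2 else -7
  -- `B` counts the steps that do not ascend. Each step gains at least `1` once `r` is added for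
  -- every such step, and the differences of `c` telescope.
  have key : ∀ (t : List V) (v z : V), (v :: (t ++ [z])).IsChain (fun x y => A y x) →
      ∃ B : ℕ, walkWeight w (v :: (t ++ [z])) = 2 * (t.length + 1) - 9 * B ∧
        (t.length + 1 : ℝ) ≤ r * B + c v - c z := by
    have step : ∀ u v, A u v → ∃ B : ℕ, w u v = 2 - 9 * B ∧ 1 ≤ r * B + c v - c u := by
      intro u v huv
      obtain ⟨h1, h2⟩ := hc u v huv
      by_cases h : c u < c v
      · refine ⟨0, by simp [w, h], ?_⟩
        rw [abs_of_neg (by linarith)] at h1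
        push_cast
        linarith
      · refine ⟨1, by simp [w, h], ?_⟩
        have := le_abs_self (c u - c v)
        push_cast
        linarith
    intro t
    induction t with
    | nil =>
      intro v z h
      obtain ⟨B, h1, h2⟩ := step z v (by simpa using h)
      exact ⟨B, by simp [walkWeight, h1], by simpa using h2⟩
    | cons u t ih =>
      intro v z h
      simp only [List.cons_append, List.isChain_cons_cons] at h
      obtain ⟨B, h1, h2⟩ := step u v h.1
      obtain ⟨B', h3, h4⟩ := ih u z h.2
      refine ⟨B + B', ?_, ?_⟩
      · simp only [List.cons_append, walkWeight, h1, h3, List.length_cons]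
        push_cast
        ring
      · simp only [List.length_cons]
        push_cast
        linarith
  obtain ⟨φ, hφ⟩ := exists_potential A w (by
    intro v l hnd hch
    obtain ⟨B, h1, h2⟩ := key l v v hch
    have hlen : l.length + 1 ≤ 15 := by
      have := hnd.length_le_card
      simp only [List.length_append, List.length_singleton] at this
      omega
    have hB : 3 * (l.length + 1) < 14 * B := by
      have hB0 : 0 < B := by
        rcases Nat.eq_zero_or_pos B with h | h
        · subst h
          have : (0 : ℝ) ≤ l.length := Nat.cast_nonneg _
          push_cast at h2
          linarith
        · exact h
      have hB' : (0 : ℝ) < B := by exact_mod_cast hB0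
      have : (3 * (l.length + 1) : ℝ) < 14 * B := by nlinarith
      exact_mod_cast this
    -- With `n = l.length + 1 ≤ 15`, `3n < 14B` forces `2n ≤ 9B`: no fraction strictly between `9/2`
    -- and `14/3` has so small a numerator.
    rw [h1]
    omega)
  refine ⟨φ, fun u v huv => ?_⟩
  have h1 := hφ u v huv
  have h2 := hφ v u (hA u v huv)
  have hne : c u ≠ c v := by
    intro h
    have := (hc u v huv).1
    rw [h] at this
    norm_num at this
  simp only [w] at h1 h2
  rcases lt_or_gt_of_ne hne with h | h
  · rw [if_pos h] at h1
    rw [if_neg h.not_gt] at h2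
    rw [abs_sub_comm, abs_of_nonneg (by omega)]
    omega
  · rw [if_neg h.not_gt] at h1
    rw [if_pos h] at h2
    rw [abs_of_nonneg (by omega)]
    omega

/-! ### The lower bound for `H`: no circular `9/2`-edge-colouring. -/

/-- The two ends of an edge of `baseMultigraph`. -/
def baseEnds : Fin 15 → Sym2 (Fin 9) :=
  ![s(0, 4), s(0, 4), s(1, 5), s(1, 5), s(0, 6), s(1, 6), s(2, 6), s(0, 7), s(1, 7),
    s(4, 7), s(5, 7), s(3, 8), s(4, 8), s(5, 8), s(6, 8)]

/-- The edges sharing an end with `e`, as a bit mask. -/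
def baseNeighbours (e : ℕ) : ℕ :=
  ([4754, 4753, 9512, 9508, 16611, 16732, 16432, 1811, 1708, 5507, 9100, 28672, 27139, 23564,
    14448] : List ℕ).getD e 0

/-- Backtracking search for a circular `9/2`-edge-colouring (colours scaled to integers mod `9`)
of `baseMultigraph`, extending the partial colouring `acc` to the edges in the first list. -/
def extends92 : List ℕ → List (ℕ × ℕ) → Bool
  | [], _ => true
  | e :: L, acc => [0, 1, 2, 3, 4, 5, 6, 7, 8].any fun x =>
      (acc.all fun p => !((baseNeighbours e).testBit p.1) ||
        ((Nat.ble (x + 2) p.2 && Nat.ble p.2 (x + 7)) ||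
          (Nat.ble (p.2 + 2) x && Nat.ble x (p.2 + 7)))) &&
      extends92 L ((e, x) :: acc)

/-- The search cannot miss an existing colouring `φ`: the branch that follows `φ` is never pruned.
-/
theorem extends92_eq_true (φ : ℕ → ℕ) (hφ : ∀ e, φ e < 9)
    (h : ∀ e f, (baseNeighbours e).testBit f = true →
      (φ e + 2 ≤ φ f ∧ φ f ≤ φ e + 7) ∨ (φ f + 2 ≤ φ e ∧ φ e ≤ φ f + 7))
    (L : List ℕ) (acc : List (ℕ × ℕ)) (hacc : ∀ p ∈ acc, p.2 = φ p.1) :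
    extends92 L acc = true := by
  induction L generalizing acc with
  | nil => rfl
  | cons e L ih =>
    rw [extends92, List.any_eq_true]
    refine ⟨φ e, ?_, ?_⟩
    · have := hφ e
      simp only [List.mem_cons, List.not_mem_nil, or_false]
      omega
    · rw [Bool.and_eq_true, List.all_eq_true]
      refine ⟨fun p hp => ?_, ih _ ?_⟩
      · cases hb : (baseNeighbours e).testBit p.1 with
        | false => rfl
        | true => simpa [hacc p hp] using h e p.1 hb
      · intro p hp
        rcases List.mem_cons.1 hp with rfl | hp
        · rfl
        · exact hacc p hp

-- Rotating the colours allows edge `5` to be fixed at `0`. In the chosen order every edge meets an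
-- earlier one, so branches are pruned early.
set_option maxRecDepth 100000 in
theorem extends92_eq_false :
    extends92 [3, 8, 2, 10, 13, 7, 9, 1, 0, 12, 4, 14, 6, 11] [(5, 0)] = false := by
  decide +kernel

theorem baseMultigraph_isLink (e : Fin 15) (x y : Fin 9) :
    baseMultigraph.IsLink e x y ↔ baseEnds e = s(x, y) := Iff.rfl

theorem baseMultigraph_inc (e : Fin 15) (x : Fin 9) :
    baseMultigraph.Inc e x ↔ x ∈ baseEnds e := Iff.rfl

theorem not_baseMultigraph_isLoopAt (e : Fin 15) (x : Fin 9) :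
    ¬ baseMultigraph.IsLoopAt e x := by
  rw [← Graph.isLink_self_iff, baseMultigraph_isLink]
  revert e x
  decide

theorem baseMultigraph_degree (x : Fin 9) :
    baseMultigraph.degree x = if x = 2 ∨ x = 3 then 1 else 4 := by
  have h1 : baseMultigraph.incidenceSet x = ↑({e | x ∈ baseEnds e} : Finset (Fin 15)) := by
    ext e
    simp [baseMultigraph_inc]
  have h2 : baseMultigraph.loopSet x = ∅ :=
    Set.eq_empty_of_forall_notMem fun e he => not_baseMultigraph_isLoopAt e x he
  rw [Graph.degree, h1, h2, Set.ncard_coe_finset, Set.ncard_empty]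
  clear h1 h2
  revert x
  decide

/-- Only this direction is needed: a missing bit would merely drop a constraint from a search that
fails anyway. -/
theorem testBit_baseNeighbours : ∀ e f : Fin 15, (baseNeighbours e).testBit f = true →
    e ≠ f ∧ ∃ x, x ∈ baseEnds e ∧ x ∈ baseEnds f := by
  decide +kernel

theorem lt_of_testBit_baseNeighbours {e f : ℕ} (h : (baseNeighbours e).testBit f = true) :
    e < 15 ∧ f < 15 := by
  have he : e < 15 := by
    by_contra he
    rw [baseNeighbours, List.getD_eq_default _ _ (by simpa using he)] at h
    simp at h
  refine ⟨he, ?_⟩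
  by_contra hf
  have hlt : baseNeighbours e < 2 ^ 15 := by
    have : ∀ e : Fin 15, baseNeighbours e < 2 ^ 15 := by decide +kernel
    exact this ⟨e, he⟩
  rw [Nat.testBit_lt_two_pow (hlt.trans_le (Nat.pow_le_pow_right (by norm_num) (by omega)))] at h
  exact Bool.false_ne_true h

/-- `baseMultigraph` has no circular `r`-edge-colouring with `r < 14/3`. -/
theorem le_of_isCircularEdgeColouring_baseMultigraph {r : ℝ} {c : Fin 15 → ℝ}
    (hc : baseMultigraph.IsCircularEdgeColouring r c) : 14 / 3 ≤ r := by
  by_contra! hr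
  obtain ⟨φ, hφ⟩ := exists_int_colouring (V := Fin 15) (by simp)
    (fun e f => e ≠ f ∧ ∃ x, x ∈ baseEnds e ∧ x ∈ baseEnds f)
    (fun e f h => ⟨h.1.symm, h.2.imp fun _ h => h.symm⟩) hr c
    (fun e f h => h.2.elim fun x hx => hc.dist_bounds e f x h.1 hx.1 hx.2)
  -- Subtracting `φ 5` gives edge `5` the colour `0` preset in the search. The value beyond `15` is
  -- irrelevant, since no mask has a bit there.
  let ψ : ℕ → ℕ := fun e => if h : e < 15 then ((φ ⟨e, h⟩ - φ 5) % 9).toNat else 0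
  have hψ : extends92 [3, 8, 2, 10, 13, 7, 9, 1, 0, 12, 4, 14, 6, 11] [(5, 0)] = true := by
    refine extends92_eq_true ψ (fun e => ?_) (fun e f h => ?_) _ _ (by simp [ψ])
    · simp only [ψ]
      split_ifs <;> omega
    · obtain ⟨he, hf⟩ := lt_of_testBit_baseNeighbours h
      have := hφ _ _ (testBit_baseNeighbours ⟨e, he⟩ ⟨f, hf⟩ h)
      simp only [ψ, dif_pos he, dif_pos hf]
      rcases abs_cases (φ ⟨e, he⟩ - φ ⟨f, hf⟩) with h | h <;> omega
  rw [extends92_eq_false] at hψ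
  exact Bool.false_ne_true hψ

/-! ### A `14/3`-colouring of `H`, and the degrees of `H`. -/

/-- A circular `14/3`-edge-colouring of `baseMultigraph` (colours scaled to integers modulo `14`)
and its image under the reflection interchanging the colours of the two pendant edges. -/
def baseColour (s : ZMod 2) (e : Fin 15) : ℕ :=
  if s = 0 then ![0, 7, 2, 9, 4, 12, 1, 10, 6, 3, 13, 0, 11, 5, 8] e
  else ![1, 8, 13, 6, 11, 3, 0, 5, 9, 12, 2, 1, 4, 10, 7] e

theorem baseColour_lt : ∀ s e, baseColour s e < 14 := by decide +kernel

theorem baseColour_dist : ∀ s e f x, e ≠ f → x ∈ baseEnds e → x ∈ baseEnds f →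
    (baseColour s e + 3 ≤ baseColour s f ∧ baseColour s f ≤ baseColour s e + 11) ∨
    (baseColour s f + 3 ≤ baseColour s e ∧ baseColour s e ≤ baseColour s f + 11) := by
  decide +kernel

/-- Consecutive copies, coloured with opposite `s`, agree on the edge that joins them. -/
theorem baseColour_add_one : ∀ s, baseColour (s - 1) 11 = baseColour s 6 := by decide +kernel

theorem dist_bounds_of_nat {m n : ℕ}
    (h : (m + 3 ≤ n ∧ n ≤ m + 11) ∨ (n + 3 ≤ m ∧ m ≤ n + 11)) :
    1 ≤ |(m / 3 : ℝ) - n / 3| ∧ |(m / 3 : ℝ) - n / 3| ≤ 14 / 3 - 1 := by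
  rcases h with ⟨h1, h2⟩ | ⟨h1, h2⟩
  · have h1' : (m : ℝ) + 3 ≤ n := by exact_mod_cast h1
    have h2' : (n : ℝ) ≤ m + 11 := by exact_mod_cast h2
    rw [abs_of_neg (by linarith)]
    constructor <;> linarith
  · have h1' : (n : ℝ) + 3 ≤ m := by exact_mod_cast h1
    have h2' : (m : ℝ) ≤ n + 11 := by exact_mod_cast h2
    rw [abs_of_pos (by linarith)]
    constructor <;> linarith

theorem div_three_mem_Ico {m : ℕ} (h : m < 14) : (m / 3 : ℝ) ∈ Set.Ico (0 : ℝ) (14 / 3) := by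
  have : (m : ℝ) < 14 := by exact_mod_cast h
  exact ⟨by positivity, by linarith⟩

theorem baseMultigraph_hasCircularChromaticIndex :
    baseMultigraph.HasCircularChromaticIndex (14 / 3) := by
  refine ⟨⟨fun e => baseColour 0 e / 3, by norm_num, not_baseMultigraph_isLoopAt,
    fun e _ => div_three_mem_Ico (baseColour_lt 0 e), fun e f x hne he hf =>
    dist_bounds_of_nat (baseColour_dist 0 e f x hne he hf)⟩, ?_⟩
  rintro r ⟨c, hc⟩
  exact le_of_isCircularEdgeColouring_baseMultigraph hc

theorem setOf_baseMultigraph_degree_eq_one :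
    {x ∈ baseMultigraph.vertexSet | baseMultigraph.degree x = 1} = {2, 3} := by
  ext x
  have hx : x ∈ baseMultigraph.vertexSet := Set.mem_univ x
  rw [Set.mem_sep_iff, baseMultigraph_degree, Set.mem_insert_iff, Set.mem_singleton_iff]
  split_ifs with h <;> simp [hx, h]

theorem ncard_baseMultigraph_degree_eq_four :
    {x ∈ baseMultigraph.vertexSet | baseMultigraph.degree x = 4}.ncard = 7 := by
  have : {x ∈ baseMultigraph.vertexSet | baseMultigraph.degree x = 4} =
      ↑({x | ¬ (x = 2 ∨ x = 3)} : Finset (Fin 9)) := by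
    ext x
    have hx : x ∈ baseMultigraph.vertexSet := Set.mem_univ x
    rw [Set.mem_sep_iff, baseMultigraph_degree, Finset.coe_filter, Set.mem_ofPred_eq]
    split_ifs with h <;> simp [hx, h]
  rw [this, Set.ncard_coe_finset]
  decide

/-! ### Incidence, regularity and size of the cyclic chain. -/

/-- The edge of `baseMultigraph.cyclicChain 2 3 k` that the edge `e` of copy `i` becomes. -/
def chainEdge {k : ℕ} (i : ZMod k) (e : Fin 15) : ZMod k × (Fin 15 ⊕ Fin 15 × Fin 15) :=
  if e = 11 then (i, Sum.inr (11, 6))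
  else if e = 6 then (i - 1, Sum.inr (11, 6)) else (i, Sum.inl e)

/-- With a single copy, the pendant edges `6` and `11` would become one edge; for `k ≥ 2` they lie
in different joints. -/
theorem chainEdge_injective {k : ℕ} (hk : 2 ≤ k) (i : ZMod k) :
    Function.Injective (chainEdge i) := by
  have : Fact (1 < k) := ⟨hk⟩
  have hi : i ≠ i - 1 := by simp [eq_sub_iff_add_eq]
  intro e f h
  simp only [chainEdge] at h
  split_ifs at h <;> simp_all

theorem baseEnds_pendant_left : ∀ e x, baseEnds e = s(2, x) ↔ e = 6 ∧ x = 6 := by decide +kernel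

theorem baseEnds_pendant_right : ∀ e x, baseEnds e = s(3, x) ↔ e = 11 ∧ x = 8 := by
  decide +kernel

theorem baseEnds_six_eleven : ∀ x, (x ∈ baseEnds 6 ↔ x = 2 ∨ x = 6) ∧
    (x ∈ baseEnds 11 ↔ x = 3 ∨ x = 8) := by
  decide +kernel

theorem mem_baseEnds_iff : ∀ (e : Fin 15) (x : Fin 9), x ≠ 2 ∧ x ≠ 3 →
    ((∃ y, (y ≠ 2 ∧ y ≠ 3) ∧ baseEnds e = s(x, y)) ↔ x ∈ baseEnds e ∧ e ≠ 6 ∧ e ≠ 11) := by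
  decide +kernel

theorem cyclicChain_isLink_inl {k : ℕ} (i : ZMod k) (e : Fin 15) (p q : ZMod k × Fin 9) :
    (baseMultigraph.cyclicChain 2 3 k).IsLink (i, Sum.inl e) p q ↔
      (p.2 ≠ 2 ∧ p.2 ≠ 3) ∧ (q.2 ≠ 2 ∧ q.2 ≠ 3) ∧ p.1 = i ∧ q.1 = i ∧ baseEnds e = s(p.2, q.2) :=
  Iff.rfl

theorem cyclicChain_isLink_inr {k : ℕ} (i : ZMod k) (f g : Fin 15) (p q : ZMod k × Fin 9) :
    (baseMultigraph.cyclicChain 2 3 k).IsLink (i, Sum.inr (f, g)) p q ↔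
      f = 11 ∧ g = 6 ∧ ((p = (i, 8) ∧ q = (i + 1, 6)) ∨ (q = (i, 8) ∧ p = (i + 1, 6))) := by
  have : (baseMultigraph.cyclicChain 2 3 k).IsLink (i, Sum.inr (f, g)) p q ↔
      (p.2 ≠ 2 ∧ p.2 ≠ 3) ∧ (q.2 ≠ 2 ∧ q.2 ≠ 3) ∧
        ((p.1 = i ∧ baseEnds f = s(3, p.2) ∧ q.1 = i + 1 ∧ baseEnds g = s(2, q.2)) ∨
        (q.1 = i ∧ baseEnds f = s(3, q.2) ∧ p.1 = i + 1 ∧ baseEnds g = s(2, p.2))) := Iff.rfl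
  rw [this]
  simp only [baseEnds_pendant_left, baseEnds_pendant_right, Prod.ext_iff]
  constructor
  · tauto
  · rintro ⟨rfl, rfl, ⟨⟨h1, h2⟩, h3, h4⟩ | ⟨⟨h1, h2⟩, h3, h4⟩⟩ <;> simp [h1, h2, h3, h4]

/-- Around each vertex the chain looks like `H`, via `chainEdge`. This reduces regularity and both
colouring bounds to `H`. -/
theorem cyclicChain_inc {k : ℕ} (a : ZMod k × (Fin 15 ⊕ Fin 15 × Fin 15)) (p : ZMod k × Fin 9) :
    (baseMultigraph.cyclicChain 2 3 k).Inc a p ↔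
      (p.2 ≠ 2 ∧ p.2 ≠ 3) ∧ ∃ e, p.2 ∈ baseEnds e ∧ a = chainEdge p.1 e := by
  obtain ⟨i, e | ⟨f, g⟩⟩ := a
  · have : (baseMultigraph.cyclicChain 2 3 k).Inc (i, Sum.inl e) p ↔ (p.2 ≠ 2 ∧ p.2 ≠ 3) ∧
        p.1 = i ∧ ∃ y, (y ≠ 2 ∧ y ≠ 3) ∧ baseEnds e = s(p.2, y) := by
      constructor
      · rintro ⟨q, h⟩
        rw [cyclicChain_isLink_inl] at h
        exact ⟨h.1, h.2.2.1, q.2, h.2.1, h.2.2.2.2⟩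
      · rintro ⟨hp, hi, y, hy, h⟩
        exact ⟨(i, y), hp, hy, hi, rfl, h⟩
    rw [this]
    refine and_congr_right fun hp => ?_
    rw [mem_baseEnds_iff e p.2 hp]
    constructor
    · rintro ⟨rfl, h, h1, h2⟩
      exact ⟨e, h, by simp [chainEdge, h1, h2]⟩
    · rintro ⟨f, hf, h⟩
      simp only [chainEdge] at h
      split_ifs at h with h1 h2
      all_goals simp only [Prod.mk.injEq, reduceCtorEq, and_false, Sum.inl.injEq] at h
      obtain ⟨rfl, rfl⟩ := h
      exact ⟨rfl, hf, h2, h1⟩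
  · have : (baseMultigraph.cyclicChain 2 3 k).Inc (i, Sum.inr (f, g)) p ↔
        f = 11 ∧ g = 6 ∧ (p = (i, 8) ∨ p = (i + 1, 6)) := by
      simp only [Graph.Inc, cyclicChain_isLink_inr]
      constructor
      · rintro ⟨q, h1, h2, h | h⟩
        · exact ⟨h1, h2, Or.inl h.1⟩
        · exact ⟨h1, h2, Or.inr h.2⟩
      · rintro ⟨h1, h2, h | h⟩
        · exact ⟨_, h1, h2, Or.inl ⟨h, rfl⟩⟩
        · exact ⟨_, h1, h2, Or.inr ⟨rfl, h⟩⟩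
    rw [this]
    constructor
    · rintro ⟨rfl, rfl, rfl | rfl⟩
      · exact ⟨by dsimp only; decide, 11, by dsimp only; decide, by simp [chainEdge]⟩
      · exact ⟨by dsimp only; decide, 6, by dsimp only; decide, by simp [chainEdge]⟩
    · rintro ⟨hp, e, he, h⟩
      simp only [chainEdge] at h
      split_ifs at h with h1 h2
      all_goals simp only [Prod.mk.injEq, reduceCtorEq, and_false, Sum.inr.injEq] at h
      · obtain ⟨rfl, rfl, rfl⟩ := h
        rw [h1, (baseEnds_six_eleven p.2).2] at he
        exact ⟨rfl, rfl, Or.inl (Prod.ext rfl (he.resolve_left hp.2))⟩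
      · obtain ⟨rfl, rfl, rfl⟩ := h
        rw [h2, (baseEnds_six_eleven p.2).1] at he
        exact ⟨rfl, rfl, Or.inr (Prod.ext (by simp) (he.resolve_left hp.1))⟩

theorem not_cyclicChain_isLoopAt {k : ℕ}
    (a : ZMod k × (Fin 15 ⊕ Fin 15 × Fin 15)) (p : ZMod k × Fin 9) :
    ¬ (baseMultigraph.cyclicChain 2 3 k).IsLoopAt a p := by
  rw [← Graph.isLink_self_iff]
  obtain ⟨i, e | ⟨f, g⟩⟩ := a
  · rw [cyclicChain_isLink_inl]
    exact fun h => not_baseMultigraph_isLoopAt e p.2 h.2.2.2.2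
  · rw [cyclicChain_isLink_inr]
    rintro ⟨-, -, ⟨h1, h2⟩ | ⟨h1, h2⟩⟩ <;> simp [h1] at h2

theorem mem_vertexSet_cyclicChain {k : ℕ} (p : ZMod k × Fin 9) :
    p ∈ (baseMultigraph.cyclicChain 2 3 k).vertexSet ↔ p.2 ≠ 2 ∧ p.2 ≠ 3 :=
  ⟨fun h => h.2, fun h => ⟨Set.mem_univ _, h⟩⟩

theorem cyclicChain_isRegular {k : ℕ} (hk : 2 ≤ k) :
    (baseMultigraph.cyclicChain 2 3 k).IsRegular 4 := by
  intro p hp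
  rw [mem_vertexSet_cyclicChain] at hp
  have h1 : (baseMultigraph.cyclicChain 2 3 k).incidenceSet p =
      chainEdge p.1 '' baseMultigraph.incidenceSet p.2 := by
    ext a
    simp only [Graph.mem_incidenceSet, cyclicChain_inc, Set.mem_image, baseMultigraph_inc]
    exact ⟨fun h => h.2.imp fun e h => ⟨h.1, h.2.symm⟩,
      fun h => ⟨hp, h.imp fun e h => ⟨h.1, h.2.symm⟩⟩⟩
  have h2 : (baseMultigraph.cyclicChain 2 3 k).loopSet p = ∅ :=
    Set.eq_empty_of_forall_notMem fun e he => not_cyclicChain_isLoopAt e p he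
  have h3 := baseMultigraph_degree p.2
  have h4 : baseMultigraph.loopSet p.2 = ∅ :=
    Set.eq_empty_of_forall_notMem fun e he => not_baseMultigraph_isLoopAt e p.2 he
  rw [if_neg (by tauto), Graph.degree, h4] at h3
  rw [Graph.degree, h1, h2, Set.ncard_image_of_injective _ (chainEdge_injective hk p.1)]
  simpa using h3

theorem cyclicChain_isFinite {k : ℕ} (hk : 2 ≤ k) :
    (baseMultigraph.cyclicChain 2 3 k).IsFinite := by
  have : NeZero k := ⟨by omega⟩
  exact ⟨Set.toFinite _, Set.toFinite _⟩

theorem card_vertexSet_cyclicChain (k : ℕ) :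
    Nat.card (baseMultigraph.cyclicChain 2 3 k).vertexSet = k * 7 := by
  have : (baseMultigraph.cyclicChain 2 3 k).vertexSet =
      Set.univ ×ˢ (↑({x | x ≠ 2 ∧ x ≠ 3} : Finset (Fin 9)) : Set (Fin 9)) := by
    ext p
    simp [mem_vertexSet_cyclicChain]
  rw [Nat.card_coe_set_eq, this, Set.ncard_prod, Set.ncard_univ, Nat.card_zmod,
    Set.ncard_coe_finset]
  congr 1

/-! ### The circular chromatic index of the cyclic chain. -/

/-- The vertices `2` and `3` disappear in the chain, but carry one edge each, so no colouring
constraint of `H` is lost with them. -/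
theorem pendant_edge_unique : ∀ e f : Fin 15, ∀ x, e ≠ f → x ∈ baseEnds e → x ∈ baseEnds f →
    x ≠ 2 ∧ x ≠ 3 := by
  decide +kernel

theorem exists_end_ne_pendant : ∀ e, ∃ x ∈ baseEnds e, x ≠ 2 ∧ x ≠ 3 := by decide +kernel

theorem cyclicChain_hasCircularChromaticIndex {k : ℕ} (hk : 2 ≤ k) (heven : Even k) :
    (baseMultigraph.cyclicChain 2 3 k).HasCircularChromaticIndex (14 / 3) := by
  constructor
  -- The parity of a copy's index is well defined modulo `k` because `k` is even.
  · let par : ZMod k →+* ZMod 2 := ZMod.castHom heven.two_dvd (ZMod 2)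
    let col : ZMod k × (Fin 15 ⊕ Fin 15 × Fin 15) → ℕ := fun a =>
      Sum.elim (baseColour (par a.1)) (fun _ => baseColour (par a.1) 11) a.2
    have hcol : ∀ i e, col (chainEdge i e) = baseColour (par i) e := by
      intro i e
      by_cases h1 : e = 11
      · subst h1; rfl
      by_cases h2 : e = 6
      · subst h2
        simp only [chainEdge, col, if_neg h1, if_pos, map_sub, map_one, Sum.elim_inr]
        exact baseColour_add_one (par i)
      · simp [chainEdge, h1, h2, col]
    refine ⟨fun a => col a / 3, by norm_num, not_cyclicChain_isLoopAt, ?_, ?_⟩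
    · rintro ⟨i, e | e⟩ - <;> exact div_three_mem_Ico (baseColour_lt _ _)
    · intro a b p hne ha hb
      obtain ⟨-, e, he, rfl⟩ := (cyclicChain_inc a p).1 ha
      obtain ⟨-, f, hf, rfl⟩ := (cyclicChain_inc b p).1 hb
      apply dist_bounds_of_nat
      rw [hcol, hcol]
      exact baseColour_dist _ e f p.2 (fun h => hne (by rw [h])) he hf
  · rintro r ⟨c, hc⟩
    -- A colouring of the chain restricts to copy `0`, the joints playing the pendant edges.
    refine le_of_isCircularEdgeColouring_baseMultigraph (c := fun e => c (chainEdge 0 e))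
      ⟨hc.one_le, not_baseMultigraph_isLoopAt, fun e _ => hc.mem_Ico _ ?_, fun e f x hne he hf =>
        hc.dist_bounds _ _ (0, x) ((chainEdge_injective hk 0).ne hne) ?_ ?_⟩
    · obtain ⟨x, hx, hx'⟩  := exists_end_ne_pendant e
      exact ((cyclicChain_inc _ (0, x)).2 ⟨hx', e, hx, rfl⟩).edge_mem
    · exact (cyclicChain_inc _ (0, x)).2 ⟨pendant_edge_unique e f x hne he hf, e, he, rfl⟩
    · exact (cyclicChain_inc _ (0, x)).2 ⟨pendant_edge_unique e f x hne he hf, f, hf, rfl⟩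

/-! ### Two-connectedness of the cyclic chain. -/

/-- A multigraph is connected if the equivalence relation generated by adjacency is total. -/
theorem Graph.isConnected_of_eqvGen {α β : Type*} {G : Graph α β} {b : α} (hb : b ∈ G.vertexSet)
    (h : ∀ p ∈ G.vertexSet, Relation.EqvGen G.Adj p b) : G.IsConnected := by
  -- The alternative `p = q` is needed because `EqvGen` is reflexive also outside the vertex set.
  have key : ∀ p q, Relation.EqvGen G.Adj p q →
      (p = q ∨ ∃ (hp : p ∈ G.vertexSet) (hq : q ∈ G.vertexSet),
        G.toSimpleGraph.Reachable ⟨p, hp⟩ ⟨q, hq⟩) := by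
    intro p q h
    induction h with
    | rel p q h =>
      by_cases hpq : p = q
      · exact Or.inl hpq
      · refine Or.inr ⟨h.left_mem, h.right_mem, SimpleGraph.Adj.reachable ?_⟩
        exact ⟨fun h => hpq (congrArg Subtype.val h), h⟩
    | refl p => exact Or.inl rfl
    | symm p q _ ih =>
      rcases ih with rfl | ⟨hp, hq, h⟩
      · exact Or.inl rfl
      · exact Or.inr ⟨hq, hp, h.symm⟩
    | trans p q r _ _ ih1 ih2 =>
      rcases ih1 with rfl | ⟨hp, hq, h⟩
      · exact ih2
      · rcases ih2 with rfl | ⟨hq', hr, h'⟩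
        · exact Or.inr ⟨hp, hq, h⟩
        · exact Or.inr ⟨hp, hr, h.trans h'⟩
  have hreach : ∀ p : G.vertexSet, G.toSimpleGraph.Reachable p ⟨b, hb⟩ := by
    rintro ⟨p, hp⟩
    rcases key p b (h p hp) with rfl | ⟨_, _, h⟩
    · rfl
    · exact h
  have : Nonempty G.vertexSet := ⟨⟨b, hb⟩⟩
  exact ⟨fun p q => (hreach p).trans (hreach q).symm⟩

/-- After the deletion of `2`, `3` and one more vertex `y` from `baseMultigraph`, every vertex has
distance at most `2` from `8`, or from `6` if `y = 8`. -/
theorem baseEnds_exists_path : ∀ y a : Fin 9, y ≠ 3 → a ≠ 2 ∧ a ≠ 3 ∧ a ≠ y →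
    ∃ m, (m ≠ 2 ∧ m ≠ 3 ∧ m ≠ y) ∧ (a = m ∨ ∃ e, baseEnds e = s(a, m)) ∧
      (m = (if y = 8 then 6 else 8) ∨ ∃ e, baseEnds e = s(m, if y = 8 then 6 else 8)) := by
  decide +kernel

theorem cyclicChain_deleteVerts_isConnected {k : ℕ} (hk : 2 ≤ k) (j : ZMod k) {y : Fin 9}
    (hy : y ≠ 3) :
    ((baseMultigraph.cyclicChain 2 3 k).deleteVerts {(j, y)}).IsConnected := by
  have : Fact (1 < k) := ⟨hk⟩
  have : NeZero k := ⟨by omega⟩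
  set D := (baseMultigraph.cyclicChain 2 3 k).deleteVerts {(j, y)} with hD
  have hstep : ∀ i a b, (a ≠ 2 ∧ a ≠ 3) → (b ≠ 2 ∧ b ≠ 3) → (i, a) ≠ (j, y) → (i, b) ≠ (j, y) →
      (a = b ∨ ∃ e, baseEnds e = s(a, b)) → Relation.EqvGen D.Adj (i, a) (i, b) := by
    rintro i a b ha hb ha' hb' (rfl | ⟨e, he⟩)
    · exact .refl _
    · refine .rel _ _ ⟨(i, Sum.inl e), ?_⟩
      rw [hD, Graph.deleteVerts_isLink, cyclicChain_isLink_inl]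
      exact ⟨⟨ha, hb, rfl, rfl, he⟩, ha', hb'⟩
  have hroot : ∀ i z, z ≠ 3 → (∀ a, a ≠ z → (i, a) ≠ (j, y) ∨ a = 2) → ∀ a, a ≠ 2 ∧ a ≠ 3 ∧ a ≠ z →
      Relation.EqvGen D.Adj (i, a) (i, if z = 8 then 6 else 8) := by
    intro i z hz hdel a ha
    obtain ⟨m, hm, h1, h2⟩ := baseEnds_exists_path z a hz ha
    have hr : (if z = 8 then 6 else 8 : Fin 9) ≠ 2 ∧ (if z = 8 then 6 else 8 : Fin 9) ≠ 3 ∧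
        (if z = 8 then 6 else 8 : Fin 9) ≠ z := by
      clear h2 hm h1 ha hdel hz
      revert z
      decide
    exact .trans _ _ _
      (hstep i a m ⟨ha.1, ha.2.1⟩ ⟨hm.1, hm.2.1⟩ ((hdel a ha.2.2).resolve_right ha.1)
        ((hdel m hm.2.2).resolve_right hm.1) h1)
      (hstep i m _ ⟨hm.1, hm.2.1⟩ ⟨hr.1, hr.2.1⟩ ((hdel m hm.2.2).resolve_right hm.1)
        ((hdel _ hr.2.2).resolve_right hr.1) h2)
  have hcopy : ∀ i, i ≠ j → ∀ a, a ≠ 2 → a ≠ 3 → Relation.EqvGen D.Adj (i, a) (i, 8) :=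
    fun i hi a h2 h3 => hroot i 2 (by decide) (fun b _ => Or.inl fun h => hi (congrArg Prod.fst h))
      a ⟨h2, h3, h2⟩
  have hjoint : ∀ i, (i, (8 : Fin 9)) ≠ (j, y) → (i + 1, (6 : Fin 9)) ≠ (j, y) →
      Relation.EqvGen D.Adj (i, 8) (i + 1, 6) := by
    intro i h1 h2
    refine .rel _ _ ⟨(i, Sum.inr (11, 6)), ?_⟩
    rw [hD, Graph.deleteVerts_isLink, cyclicChain_isLink_inr]
    exact ⟨⟨rfl, rfl, Or.inl ⟨rfl, rfl⟩⟩, h1, h2⟩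
  have hj : j + 1 ≠ j := by simp
  have hne : ∀ n : ℕ, 1 ≤ n → n < k → j + (n : ZMod k) ≠ j := by
    intro n h1 hn h
    rw [add_eq_left, ZMod.natCast_eq_zero_iff] at h
    exact absurd (Nat.le_of_dvd h1 h) (by omega)
  -- The intact copies `j + 1, …, j + (k - 1)` form a chain that avoids copy `j`.
  have hmain : ∀ n : ℕ, 1 ≤ n → n < k →
      Relation.EqvGen D.Adj (j + (n : ZMod k), 8) (j + 1, 6) := by
    intro n hn
    induction n, hn using Nat.le_induction with
    | base =>
      intro _
      simpa using (hcopy (j + 1) hj 6 (by decide) (by decide)).symm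
    | succ n hn ih =>
      intro hk'
      have h1 := hne n hn (by omega)
      have h2 := hne (n + 1) (by omega) hk'
      rw [Nat.cast_succ, ← add_assoc] at h2 ⊢
      exact .trans _ _ _ (hcopy _ h2 6 (by decide) (by decide)).symm <|
        .trans _ _ _ (hjoint _ (fun h => h1 (congrArg Prod.fst h))
          (fun h => h2 (congrArg Prod.fst h))).symm (ih (by omega))
  have hother : ∀ i, i ≠ j → Relation.EqvGen D.Adj (i, 8) (j + 1, 6) := by
    intro i hi
    have h0 : (i - j).val ≠ 0 := by
      rw [Ne, ZMod.val_eq_zero, sub_eq_zero]; exact hi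
    have := hmain (i - j).val (by omega) (ZMod.val_lt _)
    simpa using this
  refine Graph.isConnected_of_eqvGen (b := (j + 1, 6)) ?_ ?_
  · rw [hD, Graph.vertexSet_deleteVerts, Set.mem_sdiff, mem_vertexSet_cyclicChain]
    exact ⟨by dsimp only; decide, fun h => hj (congrArg Prod.fst h)⟩
  · rintro ⟨i, a⟩ hp
    rw [hD, Graph.vertexSet_deleteVerts, Set.mem_sdiff, mem_vertexSet_cyclicChain] at hp
    obtain ⟨⟨h2, h3⟩, hne'⟩ := hp
    dsimp only at h2 h3
    by_cases hi : i = j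
    · subst hi
      have hay : a ≠ y := fun h => hne' (by rw [h]; rfl)
      have hr := hroot i y hy (fun b hb => Or.inl fun h => hb (congrArg Prod.snd h)) a ⟨h2, h3, hay⟩
      refine hr.trans _ _ _ ?_
      have hpred : i - 1 ≠ i := by simp
      -- What is left of copy `j` escapes forward through `8`, or backward through `6` when `8` is
      -- the deleted vertex.
      split_ifs with h8
      · have := hjoint (i - 1) (fun h => hpred (congrArg Prod.fst h)) (by
          rw [h8]; intro h; exact absurd (congrArg Prod.snd h) (by dsimp only; decide))
        rw [sub_add_cancel] at this
        exact this.symm.trans _ _ _ (hother _ hpred)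
      · exact hjoint i (fun h => h8 (congrArg Prod.snd h).symm) (fun h => hj (congrArg Prod.fst h))
    · exact (hcopy i hi a h2 h3).trans _ _ _ (hother i hi)

theorem cyclicChain_isTwoConnected {k : ℕ} (hk : 2 ≤ k) :
    (baseMultigraph.cyclicChain 2 3 k).IsTwoConnected := by
  refine ⟨?_, ?_, ?_⟩
  · have hcard := card_vertexSet_cyclicChain k
    rw [Nat.card_coe_set_eq] at hcard
    rw [← (cyclicChain_isFinite hk).1.cast_ncard_eq, hcard]
    exact_mod_cast (by omega : 3 ≤ k * 7)
  -- The pair `(0, 2)` is not a vertex of the chain, so deleting it changes nothing.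
  · have h := cyclicChain_deleteVerts_isConnected hk 0 (y := 2) (by decide)
    have heq : (baseMultigraph.cyclicChain 2 3 k).deleteVerts {(0, 2)} =
        baseMultigraph.cyclicChain 2 3 k := by
      refine Graph.ext ?_ fun a p q => ?_
      · rw [Graph.vertexSet_deleteVerts, sdiff_eq_left, Set.disjoint_singleton_right,
          mem_vertexSet_cyclicChain]
        simp
      · rw [Graph.deleteVerts_isLink, and_iff_left_iff_imp]
        intro h
        have hp := (mem_vertexSet_cyclicChain p).1 h.left_mem
        have hq := (mem_vertexSet_cyclicChain q).1 h.right_mem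
        exact ⟨fun h => hp.1 (congrArg Prod.snd h), fun h => hq.1 (congrArg Prod.snd h)⟩
    rwa [heq] at h
  · rintro ⟨j, y⟩ hy
    exact cyclicChain_deleteVerts_isConnected hk j ((mem_vertexSet_cyclicChain _).1 hy).2

/-! ### Nonisomorphism and the main theorem. -/

theorem not_isomorphic_cyclicChain {k l : ℕ} (hkl : k ≠ l) :
    ¬ (baseMultigraph.cyclicChain 2 3 k).Isomorphic (baseMultigraph.cyclicChain 2 3 l) := by
  rintro ⟨φ, -⟩
  have := Nat.card_congr φ
  rw [card_vertexSet_cyclicChain, card_vertexSet_cyclicChain] at this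
  omega

/-- The multigraph `baseMultigraph` has two vertices of degree `1`, seven of degree `4`, and
circular chromatic index `14/3`; for every even `k ≥ 2`, joining `k` copies of it cyclically gives
a finite `2`-connected `4`-regular multigraph with circular chromatic index `4 + 2/3`; and these
multigraphs are pairwise nonisomorphic, so there are infinitely many. -/
theorem mainTheorem9 :
    ({x ∈ baseMultigraph.vertexSet | baseMultigraph.degree x = 1} = {2, 3} ∧
      {x ∈ baseMultigraph.vertexSet | baseMultigraph.degree x = 4}.ncard = 7 ∧
      baseMultigraph.HasCircularChromaticIndex (14 / 3)) ∧
    (∀ k : ℕ, 2 ≤ k → Even k →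
      (baseMultigraph.cyclicChain 2 3 k).IsFinite ∧
      (baseMultigraph.cyclicChain 2 3 k).IsTwoConnected ∧
      (baseMultigraph.cyclicChain 2 3 k).IsRegular 4 ∧
      (baseMultigraph.cyclicChain 2 3 k).HasCircularChromaticIndex (4 + 2 / 3)) ∧
    (∀ k l : ℕ, 2 ≤ k → Even k → 2 ≤ l → Even l → k ≠ l →
      ¬ (baseMultigraph.cyclicChain 2 3 k).Isomorphic (baseMultigraph.cyclicChain 2 3 l)) := by
  refine ⟨⟨setOf_baseMultigraph_degree_eq_one, ncard_baseMultigraph_degree_eq_four,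
    baseMultigraph_hasCircularChromaticIndex⟩, fun k hk heven => ⟨cyclicChain_isFinite hk,
      cyclicChain_isTwoConnected hk, cyclicChain_isRegular hk, ?_⟩,
    fun k l _ _ _ _ hkl => not_isomorphic_cyclicChain hkl⟩
  rw [show (4 + 2 / 3 : ℝ) = 14 / 3 by norm_num]
  exact cyclicChain_hasCircularChromaticIndex hk heven
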